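/- Let $b\ge 1$ be an integer. In the parking problem with $m$ buckets $1,\dots,m$ of size $b$ and $n$ keys, each key has a hash address in $\{1,\dots,m\}$; the keys are inserted one after the other, each into the first bucket, starting from its hash address and moving to the right without wrapping around, that contains fewer than $b$ keys, and a key that finds no such bucket overflows. Let $N_{m,n,k}$ be the number of the $m^n$ assignments of hash addresses to $n$ keys for which exactly $k$ keys overflow (so $N_{0,0,0}=1$, and $N_{0,n,k}=0$ for all other $n,k$), and let $$\Omega(z,w,q)=\sum_{m\ge0}\sum_{n\ge0}\sum_{k\ge0}N_{m,n,k}\,w^{bm}\,\frac{z^n}{n!}\,q^k .$$ Let $T(x)=\sum_{n\ge1}\frac{n^{n-1}}{n!}x^n$ be the tree function and let $\omega=e^{2\pi i/b}$. Theorem. In the field of fractions of the ring $\mathbb C[[z,w,q]]$ of formal power series, the elements $q^b-w^be^{bqz}$ and $\prod_{j=0}^{b-1}\bigl(1-T(\omega^jzw)/z\bigr)$ are nonzero, and $$\Omega(bz,w,q)=\frac{1}{q^b-w^be^{bqz}}\cdot\frac{\prod_{j=0}^{b-1}\bigl(q-T(\omega^jzw)/z\bigr)}{\prod_{j=0}^{b-1}\bigl(1-T(\omega^jzw)/z\bigr)}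 .$$ -/

import Mathlib

/-! ### The parking problem with buckets of size `b` -/

namespace Parking

/-- The state of a table with `m` buckets: the number of keys stored in each bucket, together with
the number of keys that have been lost (the overflow) so far. -/
abbrev State (m : ℕ) : Type := (Fin m → ℕ) × ℕ

/-- Insertion of a key with hash address `a`: the key is stored in the first non-full bucket among
`a, a + 1, …, m - 1`; there is no wrapping around, so if all of these are full, the key overflows
from the last bucket and is lost. -/
def insertKey (b : ℕ) {m : ℕ} (s : State m) (a : Fin m) : State m :=
  if h : ∃ j : Fin m, a ≤ j ∧ s.1 j < b then
    (Function.update s.1 (Fin.find (fun j => a ≤ j ∧ s.1 j < b) h)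
      (s.1 (Fin.find (fun j => a ≤ j ∧ s.1 j < b) h) + 1), s.2)
  else (s.1, s.2 + 1)

/-- The state reached from the empty table when the keys `0, 1, …, n - 1`, with hash addresses
`h 0, …, h (n - 1)`, are inserted one after the other. -/
def finalState (b : ℕ) {m n : ℕ} (h : Fin n → Fin m) : State m :=
  (List.ofFn h).foldl (insertKey b) (fun _ => 0, 0)

/-- The overflow: the number of keys that find no room in the table. -/
def overflow (b : ℕ) {m n : ℕ} (h : Fin n → Fin m) : ℕ := (finalState b h).2

/-- `N_{m,n,k}`: the number of hash tables (among the `m ^ n` assignments of hash addresses) with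
`m` buckets of size `b`, `n` keys and overflow `k`. -/
def tableCount (b m n k : ℕ) : ℕ :=
  (Finset.univ.filter fun h : Fin n → Fin m => overflow b h = k).card

/-! ### Formal power series in `z`, `w`, `q` over `ℂ` -/

/-- The ring `ℂ⟦z, w, q⟧`; the variables `z`, `w`, `q` have the indices `0`, `1`, `2`. -/
abbrev Series : Type := MvPowerSeries (Fin 3) ℂ

noncomputable section

/-- The variable `z`, marking the keys. -/
def zVar : Series := MvPowerSeries.X 0

/-- The variable `w`, marking the places in the table. -/
def wVar : Series := MvPowerSeries.X 1

/-- The variable `q`, marking the overflow. -/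
def qVar : Series := MvPowerSeries.X 2

/-- `Ω(z, w, q) = ∑_{m, n, k ≥ 0} N_{m,n,k} w ^ (b m) (z ^ n / n!) q ^ k`. -/
def Omega (b : ℕ) : Series := fun d =>
  if b ∣ d 1 then (tableCount b (d 1 / b) (d 0) (d 2) : ℂ) / ((d 0).factorial : ℂ) else 0

/-- `Ω(b z, w, q)`. -/
def OmegaScaled (b : ℕ) : Series := MvPowerSeries.rescale ![(b : ℂ), 1, 1] (Omega b)

/-- The tree function `T(x) = ∑_{n ≥ 1} n ^ (n - 1) / n! * x ^ n`. -/
def treeSeries : PowerSeries ℂ :=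
  PowerSeries.mk fun n => if n = 0 then 0 else (n : ℂ) ^ (n - 1) / (n.factorial : ℂ)

/-- The primitive `b`-th root of unity `ω = exp (2 π i / b)`. -/
def omegaRoot (b : ℕ) : ℂ := Complex.exp (2 * Real.pi * Complex.I / b)

/-- `T(ω ^ j z w)`. -/
def treeAt (b j : ℕ) : Series :=
  PowerSeries.subst (MvPowerSeries.C (omegaRoot b ^ j) * zVar * wVar) treeSeries

/-- `exp (b q z)`. -/
def expAt (b : ℕ) : Series :=
  PowerSeries.subst ((b : Series) * qVar * zVar) (PowerSeries.exp ℂ)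

/-- The field of fractions of `ℂ⟦z, w, q⟧`. -/
abbrev SeriesField : Type := FractionRing Series

/-- The inclusion of `ℂ⟦z, w, q⟧` in its field of fractions. -/
abbrev toField : Series →+* SeriesField := algebraMap Series SeriesField

/-- `z` as an element of the field of fractions. -/
def zF : SeriesField := toField zVar

/-- `w` as an element of the field of fractions. -/
def wF : SeriesField := toField wVar

/-- `q` as an element of the field of fractions. -/
def qF : SeriesField := toField qVar

/-- `T(ω ^ j z w)` as an element of the field of fractions. -/
def treeF (b j : ℕ) : SeriesField := toField (treeAt b j)

/-- `exp (b q z)` as an element of the field of fractions. -/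
def expF (b : ℕ) : SeriesField := toField (expAt b)

end

end Parking

open Parking

/-! ### Recursion on the number of buckets. -/

namespace Parking

/-! The proof is the kernel method. Only the number `l` of keys arriving at a new last bucket
matters: it is the overflow of the other buckets plus the keys addressed there, and `l - b` keys
(truncated) are lost. In generating functions (`qVar_pow_mul_Omega`, then `z` replaced by `bz`) this
reads `(q^b - w^b e^{bqz}) Ω(bz,w,q) = q^b + ∑_{s<b} (q^b - q^s) B_s`, with unknown series `B_s`
free of `q`.

By `T(x) = x e^{T(x)}` (`treeSeries_eq`, from Abel's identity), the series `T(ω^j zw)/z` are `b`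
distinct roots of the kernel on the left. The right side, a polynomial in `q` of degree at most `b`,
vanishes at them, so it is `L ∏ (q - T(ω^j zw)/z)` (`boundaryPoly_eq`). At `q = 1` it equals `1`,
which determines `L` without computing any `B_s` (`kernel_identity`). -/

theorem insertKey_eq_update {b m : ℕ} {s : State m} {a j : Fin m} (haj : a ≤ j) (hj : s.1 j < b)
    (hlt : ∀ i < j, a ≤ i → b ≤ s.1 i) :
    insertKey b s a = (Function.update s.1 j (s.1 j + 1), s.2) := by
  have h : ∃ j : Fin m, a ≤ j ∧ s.1 j < b := ⟨j, haj, hj⟩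
  have hf : Fin.find (fun j => a ≤ j ∧ s.1 j < b) h = j :=
    (Fin.find_eq_iff h).2 ⟨⟨haj, hj⟩, fun i hi hi' => absurd (hlt i hi hi'.1) (not_le.2 hi'.2)⟩
  rw [insertKey, dif_pos h, hf]

theorem insertKey_eq_overflow {b m : ℕ} {s : State m} {a : Fin m}
    (hfull : ∀ i, a ≤ i → b ≤ s.1 i) : insertKey b s a = (s.1, s.2 + 1) := by
  rw [insertKey, dif_neg]
  rintro ⟨j, h1, h2⟩
  exact absurd (hfull j h1) (not_le.2 h2)

/-- The state of a table with `m + 1` buckets, if `s` is the state of its first `m` buckets and `c`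
keys have the last bucket as hash address. -/
def extendState (b : ℕ) {m : ℕ} (s : State m) (c : ℕ) : State (m + 1) :=
  (Fin.snoc s.1 (min b (s.2 + c)), s.2 + c - b)

theorem insertKey_extendState_of_full {b m : ℕ} {s : State m} {c : ℕ} {a : Fin (m + 1)}
    (hfull : ∀ i : Fin m, a ≤ i.castSucc → b ≤ s.1 i) :
    insertKey b (extendState b s c) a = extendState b s (c + 1) := by
  rcases lt_or_ge (s.2 + c) b with h | h
  · rw [insertKey_eq_update (Fin.le_last a) (by simp [extendState, h])]
    · have h1 : min b (s.2 + c) = s.2 + c := by omega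
      have h2 : min b (s.2 + (c + 1)) = s.2 + c + 1 := by omega
      have h3 : s.2 + (c + 1) - b = s.2 + c - b := by omega
      simp [extendState, h1, h2, h3, Fin.update_snoc_last]
    · intro i hi hai
      induction i using Fin.lastCases with
      | last => exact absurd hi (lt_irrefl _)
      | cast i => simpa [extendState] using hfull i hai
  · rw [insertKey_eq_overflow]
    · have h1 : min b (s.2 + c) = b := by omega
      have h2 : min b (s.2 + (c + 1)) = b := by omega
      have h3 : s.2 + (c + 1) - b = s.2 + c - b + 1 := by omega
      simp [extendState, h1, h2, h3]
    · intro i hai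
      induction i using Fin.lastCases with
      | last => simp [extendState, h]
      | cast i => simpa [extendState] using hfull i hai

theorem insertKey_extendState_last {b m : ℕ} (s : State m) (c : ℕ) :
    insertKey b (extendState b s c) (Fin.last m) = extendState b s (c + 1) :=
  insertKey_extendState_of_full fun i hi => absurd hi (not_le.2 (Fin.castSucc_lt_last i))

/-- A key overflowing from the first `m` buckets moves on to the last one, and `extendState` depends
on overflow and `c` only through `s.2 + c`. So the order in which the two kinds of keys are
interleaved is irrelevant. -/
theorem insertKey_extendState_castSucc {b m : ℕ} (s : State m) (c : ℕ) (a : Fin m) :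
    insertKey b (extendState b s c) a.castSucc = extendState b (insertKey b s a) c := by
  by_cases h : ∃ j : Fin m, a ≤ j ∧ s.1 j < b
  · obtain ⟨h1, h2⟩ := Fin.find_spec h
    have h3 : ∀ i < Fin.find _ h, a ≤ i → b ≤ s.1 i := fun i hi hai => by
      simpa [hai] using Fin.find_min h hi
    rw [insertKey_eq_update h1 h2 h3,
      insertKey_eq_update (j := (Fin.find _ h).castSucc) (by simpa using h1)
        (by simpa [extendState] using h2)]
    · simp [extendState, Fin.snoc_update]
    · intro i hi hai
      induction i using Fin.lastCases with
      | last => exact absurd hi (not_lt.2 (Fin.le_last _))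
      | cast i => simpa [extendState] using h3 i (by simpa using hi) (by simpa using hai)
  · push Not at h
    rw [insertKey_eq_overflow h, insertKey_extendState_of_full fun i hi => h i (by simpa using hi)]
    simp [extendState, add_comm, add_left_comm]

theorem sum_fin_succ_fun {M : Type*} [AddCommMonoid M] {n m : ℕ} (φ : (Fin (n + 1) → Fin m) → M) :
    ∑ h, φ h = ∑ a, ∑ h : Fin n → Fin m, φ (Fin.cons a h) := by
  rw [← (Fin.consEquiv fun _ => Fin m).sum_comp, Fintype.sum_prod_type]
  rfl

/-- The binomial coefficient chooses which keys avoid the last bucket. Splitting on the address of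
the first key turns the induction step into Pascal's rule. -/
theorem sum_foldl_insertKey_extendState {M : Type*} [AddCommMonoid M] (b : ℕ) {m : ℕ}
    (ψ : State (m + 1) → M) (n : ℕ) (s : State m) (c : ℕ) :
    ∑ h : Fin n → Fin (m + 1), ψ ((List.ofFn h).foldl (insertKey b) (extendState b s c)) =
      ∑ ij ∈ Finset.HasAntidiagonal.antidiagonal n, n.choose ij.1 • ∑ h : Fin ij.1 → Fin m,
        ψ (extendState b ((List.ofFn h).foldl (insertKey b) s) (c + ij.2)) := by
  induction n generalizing s c with
  | zero => simp
  | succ n ih =>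
    rw [Finset.sum_antidiagonal_choose_succ_nsmul (fun i j => ∑ h : Fin i → Fin m,
        ψ (extendState b ((List.ofFn h).foldl (insertKey b) s) (c + j))) n,
      sum_fin_succ_fun, Fin.sum_univ_castSucc, add_comm]
    congr 1
    · simp [List.ofFn_succ, insertKey_extendState_last, ih, add_comm, add_left_comm]
    · simp only [List.ofFn_succ, Fin.cons_zero, Fin.cons_succ, List.foldl_cons,
        insertKey_extendState_castSucc, ih, sum_fin_succ_fun]
      rw [Finset.sum_comm]
      refine Finset.sum_congr rfl fun ij hij => ?_
      rw [← Finset.smul_sum, Nat.choose_symm_of_eq_add (Finset.HasAntidiagonal.mem_antidiagonal.1 hij).symm]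

/-- The number of hash tables with `m` buckets, `n` keys, and further keys that are sent past the
last bucket, such that `l` keys in total arrive there. -/
def arrivalCount (b m n l : ℕ) : ℕ :=
  ∑ ij ∈ Finset.HasAntidiagonal.antidiagonal n, n.choose ij.1 * if ij.2 ≤ l then tableCount b m ij.1 (l - ij.2) else 0

theorem arrivalCount_eq (b m n l : ℕ) : arrivalCount b m n l =
    ∑ ij ∈ Finset.HasAntidiagonal.antidiagonal n, n.choose ij.1 *
      (Finset.univ.filter fun h : Fin ij.1 → Fin m => overflow b h + ij.2 = l).card := by
  refine Finset.sum_congr rfl fun ij _ => ?_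
  congr 1
  split_ifs with h
  · rw [tableCount]
    congr 1
    ext x
    simp only [Finset.mem_filter, Finset.mem_univ, true_and]
    omega
  · symm
    rw [Finset.card_eq_zero, Finset.filter_eq_empty_iff]
    intro x _
    omega

theorem tableCount_succ (b m n k : ℕ) : tableCount b (m + 1) n k =
    ∑ ij ∈ Finset.HasAntidiagonal.antidiagonal n, n.choose ij.1 *
      (Finset.univ.filter fun h : Fin ij.1 → Fin m => overflow b h + ij.2 - b = k).card := by
  have h0 : ((fun _ => 0, 0) : State (m + 1)) = extendState b (fun _ => 0, 0) 0 := by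
    simp only [extendState, Prod.mk.injEq]
    refine ⟨?_, by simp⟩
    ext i
    induction i using Fin.lastCases <;> simp
  simp only [tableCount, overflow, finalState, Finset.card_filter, h0]
  rw [sum_foldl_insertKey_extendState b (fun s : State (m + 1) => if s.2 = k then 1 else 0)]
  simp [extendState]
  exact Finset.sum_congr rfl fun _ _ => by congr

theorem tableCount_succ_succ (b m n k : ℕ) :
    tableCount b (m + 1) n (k + 1) = arrivalCount b m n (k + 1 + b) := by
  rw [tableCount_succ, arrivalCount_eq]
  refine Finset.sum_congr rfl fun ij _ => ?_
  congr 2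
  ext x
  simp only [Finset.mem_filter, Finset.mem_univ, true_and]
  omega

/-- Truncation merges all arrival numbers `l ≤ b` into overflow `0`; positive overflow has a single
source. -/
theorem tableCount_succ_zero (b m n : ℕ) :
    tableCount b (m + 1) n 0 = ∑ l ∈ Finset.range (b + 1), arrivalCount b m n l := by
  simp only [tableCount_succ, arrivalCount_eq]
  rw [Finset.sum_comm]
  refine Finset.sum_congr rfl fun ij _ => ?_
  rw [← Finset.mul_sum]
  congr 1
  rw [Finset.card_eq_sum_card_fiberwise (f := fun h => overflow b h + ij.2)
    (t := Finset.range (b + 1))]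
  · refine Finset.sum_congr rfl fun l hl => ?_
    congr 1
    ext x
    simp only [Finset.mem_filter, Finset.mem_univ, true_and, Finset.mem_range] at hl ⊢
    omega
  · intro x hx
    simp only [Finset.coe_filter, Finset.mem_univ, true_and, Set.mem_ofPred_eq, Finset.coe_range,
      Set.mem_Iio] at hx ⊢
    omega

theorem tableCount_zero (b n k : ℕ) : tableCount b 0 n k = if n = 0 ∧ k = 0 then 1 else 0 := by
  rcases n with _ | n
  · by_cases hk : k = 0 <;> simp [tableCount, overflow, finalState, hk, eq_comm]
  · simp [tableCount]

end Parking

/-! ### Abel's identity and the tree function. -/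

namespace Parking

/-- This is the `n`-th finite difference at `0` of a power of degree below `n`. -/
theorem sum_choose_mul_neg_one_pow_mul_pow {n j : ℕ} (h : j < n) :
    ∑ k ∈ Finset.range (n + 1), (n.choose k : ℂ) * (-1) ^ (n - k) * (k : ℂ) ^ j = 0 := by
  have h1 := congrFun (fwdDiff_iter_pow_eq_zero_of_lt (R := ℂ) h) 0
  rw [fwdDiff_iter_eq_sum_shift] at h1
  simpa [mul_comm] using h1

open Polynomial in
/-- Abel's identity. -/
theorem abel_sum_polynomial (n : ℕ) :
    ∑ k ∈ Finset.range (n + 2), ((n + 1).choose k : ℂ[X]) * (k : ℂ[X]) ^ (k - 1) *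
      (X - (k : ℂ[X])) ^ (n + 1 - k) = X ^ (n + 1) + (n + 1 : ℂ[X]) * X ^ n := by
  induction n with
  | zero => simp [Finset.sum_range_succ]
  | succ n ih =>
    rw [← sub_eq_zero]
    set p : ℂ[X] := _ - _ with hp
    -- Differentiation turns the identity into `n + 2` times the preceding one.
    have hd : derivative p = 0 := by
      rw [hp, derivative_sub, sub_eq_zero, derivative_sum, Finset.sum_range_succ]
      have hlast : derivative (((n + 1 + 1).choose (n + 2) : ℂ[X]) *
          ((n + 2 : ℕ) : ℂ[X]) ^ (n + 2 - 1) *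
            (X - ((n + 2 : ℕ) : ℂ[X])) ^ (n + 1 + 1 - (n + 2))) = 0 := by
        simp [derivative_pow]
      rw [hlast, add_zero]
      have hterm : ∀ k ∈ Finset.range (n + 2), derivative (((n + 1 + 1).choose k : ℂ[X]) *
          (k : ℂ[X]) ^ (k - 1) * (X - (k : ℂ[X])) ^ (n + 1 + 1 - k)) =
          (n + 2 : ℂ[X]) * (((n + 1).choose k : ℂ[X]) * (k : ℂ[X]) ^ (k - 1) *
            (X - (k : ℂ[X])) ^ (n + 1 - k)) := by
        intro k hk
        have hk' : k ≤ n + 1 := Nat.lt_succ_iff.1 (Finset.mem_range.1 hk)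
        have hc : ((n + 1 + 1).choose k : ℂ[X]) * ((n + 1 + 1 - k : ℕ) : ℂ[X]) =
            (n + 2 : ℂ[X]) * ((n + 1).choose k : ℂ[X]) := by
          have := Nat.choose_mul_succ_eq (n + 1) k
          have := congrArg (Nat.cast : ℕ → ℂ[X]) this
          push_cast [hk'] at this ⊢
          linear_combination -this
        have he : n + 1 + 1 - k - 1 = n + 1 - k := by omega
        simp only [derivative_mul, derivative_pow, derivative_natCast, derivative_sub,
          derivative_X, he, C_eq_natCast]
        linear_combination ((k : ℂ[X]) ^ (k - 1) * (X - (k : ℂ[X])) ^ (n + 1 - k)) * hc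
      rw [Finset.sum_congr rfl hterm, ← Finset.mul_sum, ih]
      have h2 : derivative (n : ℂ[X]) = 0 := derivative_natCast
      simp only [derivative_add, derivative_mul, derivative_pow, derivative_X, derivative_natCast,
        derivative_one, C_eq_natCast, Nat.add_sub_cancel]
      push_cast
      ring
    -- At `X = 0` the powers of `k` combine to `± k^(n+1)`, leaving a finite difference of order `n
    -- + 2`.
    have h0 : p.eval 0 = 0 := by
      refine Eq.trans ?_ (sum_choose_mul_neg_one_pow_mul_pow (show n + 1 < n + 1 + 1 by omega))
      rw [hp]
      simp only [eval_sub, eval_finsetSum, eval_mul, eval_pow, eval_X, eval_natCast, eval_add]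
      simp only [ne_eq, Nat.add_eq_zero_iff, one_ne_zero, and_false, not_false_eq_true, zero_pow,
        mul_zero, add_zero, sub_zero]
      refine Finset.sum_congr rfl fun k hk => ?_
      have hk' : k ≤ n + 2 := Nat.lt_succ_iff.1 (Finset.mem_range.1 hk)
      rcases k with _ | k
      · simp
      · rw [zero_sub, neg_pow]
        have : n + 1 = (k + 1 - 1) + (n + 1 + 1 - (k + 1)) := by omega
        conv_rhs => rw [this, pow_add]
        rw [← this]
        ring
    rw [eq_C_of_derivative_eq_zero hd, coeff_zero_eq_eval_zero, h0, C_0]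

open PowerSeries

theorem abel_sum (n : ℕ) :
    ∑ k ∈ Finset.range (n + 2), ((n + 1).choose k : ℂ) * (k : ℂ) ^ (k - 1) *
      ((n + 1 - k : ℕ) : ℂ) ^ (n + 1 - k) = 2 * (n + 1 : ℂ) ^ (n + 1) := by
  have h := congrArg (Polynomial.eval (n + 1 : ℂ)) (abel_sum_polynomial n)
  simp only [Polynomial.eval_sub, Polynomial.eval_finsetSum, Polynomial.eval_mul,
    Polynomial.eval_pow, Polynomial.eval_X, Polynomial.eval_natCast, Polynomial.eval_add,
    Polynomial.eval_one] at h
  rw [show (2 : ℂ) * (n + 1 : ℂ) ^ (n + 1) = (n + 1 : ℂ) ^ (n + 1) + (n + 1) * (n + 1) ^ n by ring,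
    ← h]
  refine Finset.sum_congr rfl fun k hk => ?_
  rw [Nat.cast_sub (Nat.lt_succ_iff.1 (Finset.mem_range.1 hk))]
  push_cast
  rfl

/-- Abel's identity at `X = n + 1` in the form of a differential equation for `T`, from which `T = x
e^T` will follow. -/
theorem one_sub_treeSeries_mul : (1 - treeSeries) * (1 + X * d⁄dX ℂ treeSeries) = 1 := by
  -- With truncated subtraction `0 ^ (0 - 1) = 1`, so the uniform formula belongs to `1 + T`.
  have h1 : ∀ n, coeff n (1 + treeSeries) = (n : ℂ) ^ (n - 1) / (n.factorial : ℂ) := by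
    intro n
    rcases n with _ | n <;> simp [treeSeries, coeff_one]
  have h2 : ∀ n, coeff n (1 + X * d⁄dX ℂ treeSeries) = (n : ℂ) ^ n / (n.factorial : ℂ) := by
    intro n
    rcases n with _ | n
    · simp
    · rw [map_add, coeff_succ_X_mul, coeff_derivative]
      simp [treeSeries, coeff_one]
      ring
  have h3 : (1 + treeSeries) * (1 + X * d⁄dX ℂ treeSeries) =
      2 * (1 + X * d⁄dX ℂ treeSeries) - 1 := by
    ext n
    rw [coeff_mul, map_sub, two_mul, map_add]
    simp only [h1, h2]
    rw [Finset.Nat.sum_antidiagonal_eq_sum_range_succ (fun i j => (i : ℂ) ^ (i - 1) /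
      (i.factorial : ℂ) * ((j : ℂ) ^ j / (j.factorial : ℂ)))]
    rcases n with _ | n
    · simp
    · have hf : ((n + 1).factorial : ℂ) ≠ 0 := Nat.cast_ne_zero.2 (Nat.factorial_ne_zero _)
      have h := abel_sum n
      rw [← mul_right_inj' (inv_ne_zero hf), Finset.mul_sum] at h
      have : coeff (n + 1) (1 : ℂ⟦X⟧) = 0 := by simp [coeff_one]
      rw [this, sub_zero]
      calc _ = _ := ?_
        _ = _ := h
        _ = _ := by push_cast; ring
      refine Finset.sum_congr rfl fun k hk => ?_
      rw [Nat.cast_choose ℂ (Nat.lt_succ_iff.1 (Finset.mem_range.1 hk))]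
      field_simp
  linear_combination -h3

theorem hasSubst_treeSeries : HasSubst treeSeries :=
  HasSubst.of_constantCoeff_zero' (by simp [treeSeries])

/-- The functional equation `T(x) = x * exp (T(x))` of the tree function. -/
theorem treeSeries_eq : treeSeries = X * (exp ℂ).subst treeSeries := by
  set E := (exp ℂ).subst treeSeries with hE
  have hE' : d⁄dX ℂ E = E * d⁄dX ℂ treeSeries := by
    rw [hE, derivative_subst hasSubst_treeSeries, derivative_exp]
  have hE0 : constantCoeff E = 1 := by
    rw [← coeff_zero_eq_constantCoeff_apply, hE, coeff_subst' hasSubst_treeSeries, finsum_eq_single _ 0]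
    · simp
    · intro n hn
      simp [treeSeries, hn]
  rw [← sub_eq_zero]
  set D := treeSeries - X * E with hD
  -- Comparing coefficients of `x^n` here expresses `(n - 1) d_n` through earlier `d_i`.
  have hD' : X * d⁄dX ℂ D = (1 + X * d⁄dX ℂ treeSeries) * D := by
    have h1 := one_sub_treeSeries_mul
    have h2 : d⁄dX ℂ D = d⁄dX ℂ treeSeries - (X * d⁄dX ℂ E + E) := by
      rw [hD, map_sub, Derivation.leibniz, derivative_X]
      simp
    rw [h2, hE', hD]
    linear_combination h1
  ext n
  induction n using Nat.strong_induction_on with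
  | _ n ih =>
    rcases n with _ | _ | n
    · simp [hD, treeSeries]
    -- The recursion is void at `n = 1`, so this coefficient is computed directly.
    · rw [zero_add, hD, map_sub, show (1 : ℕ) = 0 + 1 from rfl, coeff_succ_X_mul,
        coeff_zero_eq_constantCoeff_apply, hE0]
      simp [treeSeries]
    · have h := congrArg (coeff (n + 2)) hD'
      rw [coeff_succ_X_mul, coeff_derivative, coeff_mul,
        Finset.sum_eq_single_of_mem (0, n + 2) (by simp)] at h
      · have h0 : coeff 0 (1 + X * d⁄dX ℂ treeSeries) = 1 := by simp
        rw [h0, one_mul] at h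
        have h1 : (n + 1 : ℂ) * coeff (n + 2) D = 0 := by
          push_cast at h
          linear_combination h
        simpa [Nat.cast_add_one_ne_zero] using h1
      · rintro ⟨i, j⟩ hij hne
        have hij' : i + j = n + 2 := by simpa using hij
        have hj : j < n + 2 := by
          rcases Nat.eq_zero_or_pos i with rfl | hi
          · exact absurd (by simp_all) hne
          · omega
        rw [ih j hj]
        simp
end Parking

/-! ### The functional equation of `Ω`. -/

namespace Parking

open MvPowerSeries Finsupp

theorem coeff_expAt (b : ℕ) (d : Fin 3 →₀ ℕ) :
    coeff d (expAt b) =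
      if d 1 = 0 ∧ d 0 = d 2 then (b : ℂ) ^ d 0 / ((d 0).factorial : ℂ) else 0 := by
  have ha : (b : Series) * qVar * zVar =
      monomial (single 2 1 + single 0 1 : Fin 3 →₀ ℕ) (b : ℂ) := by
    have hb : (b : Series) = monomial 0 (b : ℂ) := (map_natCast (C (σ := Fin 3) (R := ℂ)) b).symm
    rw [hb, qVar, zVar, X, X, monomial_mul_monomial, monomial_mul_monomial]
    simp
  have hs : PowerSeries.HasSubst ((b : Series) * qVar * zVar) :=
    PowerSeries.HasSubst.of_constantCoeff_zero (by simp [zVar])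
  have hpow : ∀ n, coeff d (((b : Series) * qVar * zVar) ^ n) =
      if d 1 = 0 ∧ d 0 = n ∧ d 2 = n then (b : ℂ) ^ n else 0 := by
    intro n
    rw [ha, monomial_pow, coeff_monomial]
    congr 1
    simp [Finsupp.ext_iff, Fin.forall_fin_succ]
    tauto
  rw [expAt, PowerSeries.coeff_subst hs, finsum_eq_single _ (d 0)]
  · rw [hpow, PowerSeries.coeff_exp]
    by_cases h : d 1 = 0 ∧ d 0 = d 2
    · simp [h.1, ← h.2, div_eq_inv_mul]
    · rw [if_neg h, if_neg (by tauto), smul_zero]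
  · intro n hn
    rw [hpow, if_neg (by tauto), smul_zero]

theorem coeff_Omega (b : ℕ) (d : Fin 3 →₀ ℕ) : coeff d (Omega b) =
    if b ∣ d 1 then (tableCount b (d 1 / b) (d 0) (d 2) : ℂ) / ((d 0).factorial : ℂ) else 0 :=
  rfl

/-- Each key sent past the table adds one key and one arrival, hence a factor `qz`; exponential
generating functions multiply by binomial convolution. -/
theorem coeff_expAt_mul_Omega (b : ℕ) (d : Fin 3 →₀ ℕ) : coeff d (expAt 1 * Omega b) =
    if b ∣ d 1 then (arrivalCount b (d 1 / b) (d 0) (d 2) : ℂ) / ((d 0).factorial : ℂ) else 0 := by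
  classical
  let e : Fin 3 →₀ ℕ := single 0 1 + single 2 1
  have hsum : coeff d (expAt 1 * Omega b) =
      ∑ ij ∈ (Finset.HasAntidiagonal.antidiagonal (d 0)).filter (fun ij => ij.2 ≤ d 2),
        coeff (ij.2 • e) (expAt 1) * coeff (d - ij.2 • e) (Omega b) := by
    rw [coeff_mul]
    symm
    refine Finset.sum_of_injOn (fun ij => (ij.2 • e, d - ij.2 • e)) ?_ ?_ ?_ (fun _ _ => rfl)
    · rintro ⟨i, j⟩ h ⟨i', j'⟩ h' heq
      simp only [Finset.coe_filter, Finset.HasAntidiagonal.mem_antidiagonal, Set.mem_ofPred_eq] at h h'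
      have : j = j' := by simpa [e] using DFunLike.congr_fun (congrArg Prod.fst heq) 0
      ext <;> simp <;> omega
    · rintro ⟨i, j⟩ h
      simp only [Finset.coe_filter, Finset.HasAntidiagonal.mem_antidiagonal, Set.mem_ofPred_eq] at h
      simp only [Finset.mem_coe, Finset.HasAntidiagonal.mem_antidiagonal]
      ext i
      fin_cases i <;> simp [e] <;> omega
    · rintro ⟨x, y⟩ hxy hn
      simp only [Finset.HasAntidiagonal.mem_antidiagonal] at hxy
      rw [coeff_expAt]
      split_ifs with h
      · exfalso
        apply hn
        have h0 : x 0 + y 0 = d 0 := DFunLike.congr_fun hxy 0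
        have h2 : x 2 + y 2 = d 2 := DFunLike.congr_fun hxy 2
        have hx : x 0 • e = x := by
          ext i
          fin_cases i <;> simp [e, h.1, h.2]
        refine ⟨(y 0, x 0), ?_, ?_⟩
        · simp only [Finset.coe_filter, Finset.HasAntidiagonal.mem_antidiagonal, Set.mem_ofPred_eq]
          have hx2 : x 0 = x 2 := h.2
          omega
        · simp only [hx, ← hxy, add_tsub_cancel_left]
      · simp
  rw [hsum]
  split_ifs with hb
  · rw [arrivalCount, Nat.cast_sum, Finset.sum_div, Finset.sum_filter]
    refine Finset.sum_congr rfl fun ij hij => ?_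
    have hij' : ij.1 + ij.2 = d 0 := Finset.HasAntidiagonal.mem_antidiagonal.1 hij
    split_ifs with h
    · have h0 : d 0 - ij.2 = ij.1 := by omega
      rw [coeff_expAt, coeff_Omega, ← hij', Nat.cast_mul, Nat.cast_add_choose]
      have hf : ((ij.1 + ij.2).factorial : ℂ) ≠ 0 := Nat.cast_ne_zero.2 (Nat.factorial_ne_zero _)
      simp [e, h0, hb]
      field_simp
    · simp
  · refine Finset.sum_eq_zero fun ij _ => ?_
    rw [coeff_Omega]
    simp [e, hb]

/-- The coefficient of `q ^ s`, as a series that does not depend on `q`. -/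
noncomputable def qCoeff (s : ℕ) (f : Series) : Series :=
  fun d => if d 2 = 0 then coeff (d + single 2 s) f else 0

theorem coeff_qCoeff (s : ℕ) (f : Series) (d : Fin 3 →₀ ℕ) :
    coeff d (qCoeff s f) = if d 2 = 0 then coeff (d + single 2 s) f else 0 := rfl

theorem coeff_X_pow_mul_apply (i : Fin 3) (n : ℕ) (f : Series) (d : Fin 3 →₀ ℕ) :
    coeff d ((X i : Series) ^ n * f) = if n ≤ d i then coeff (d - single i n) f else 0 := by
  rw [X_pow_eq, coeff_monomial_mul]
  simp [Finsupp.single_le_iff]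

/-- After multiplication by `q^b`, a new bucket with `l` arrivals has weight `q^(max l b)`; the sum
replaces `q^s` by `q^b` for `s < b`. The lone `q^b` is the empty table. -/
theorem qVar_pow_mul_Omega {b : ℕ} (hb : 1 ≤ b) :
    qVar ^ b * Omega b = qVar ^ b + wVar ^ b * (expAt 1 * Omega b +
      ∑ s ∈ Finset.range b, (qVar ^ b - qVar ^ s) * qCoeff s (expAt 1 * Omega b)) := by
  set F := expAt 1 * Omega b with hF
  ext d
  rw [map_add, qVar, wVar, coeff_X_pow_mul_apply, coeff_X_pow_mul_apply, coeff_X_pow]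
  simp only [map_add, map_sum, sub_mul, map_sub, coeff_X_pow_mul_apply, coeff_qCoeff]
  have hd : d = single 2 b ↔ d 0 = 0 ∧ d 1 = 0 ∧ d 2 = b := by
    simp [Finsupp.ext_iff, Fin.forall_fin_succ]
  rw [if_congr hd rfl rfl]
  simp only [hF, coeff_expAt_mul_Omega, coeff_Omega]
  simp only [Finsupp.coe_tsub, Finsupp.coe_add, Pi.sub_apply, Pi.add_apply, single_apply]
  simp
  generalize d 0 = n
  generalize d 1 = M
  generalize d 2 = k
  have hif : (if n = 0 ∧ M = 0 ∧ k = b then 1 else 0 : ℂ) =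
      if M = 0 then if n = 0 ∧ k = b then 1 else 0 else 0 := by
    split_ifs <;> first | rfl | (exfalso; tauto)
  rw [hif]
  by_cases hM : b ∣ M
  swap
  · have h0 : M ≠ 0 := by rintro rfl; exact hM (dvd_zero b)
    have h1 : b ≤ M → ¬ M ≤ b := fun h h' => hM (le_antisymm h h' ▸ dvd_rfl)
    by_cases h2 : b ≤ M <;> simp [hM, h0, h2, h1]
  obtain ⟨m, rfl⟩ := hM
  rcases m with _ | m
  · have hb0 : b ≠ 0 := by omega
    rcases le_or_gt b k with h | h
    · have : k - b = 0 ↔ k = b := by omega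
      by_cases hn : n = 0 <;> simp [tableCount_zero, h, this, hn, hb0]
    · simp [not_le.2 h, h.ne, hb0]
  · have hdiv : (b * (m + 1) - b) / b = m := by
      rw [Nat.mul_succ, Nat.add_sub_cancel, Nat.mul_div_cancel_left _ hb]
    have hdiv' : b * (m + 1) / b = m + 1 := Nat.mul_div_cancel_left _ hb
    have hle : b ≤ b * (m + 1) := Nat.le_mul_of_pos_right b (Nat.succ_pos m)
    have hne : b * (m + 1) ≠ 0 := by omega
    have hsum : (∑ x ∈ Finset.range b, if x ≤ k then
          if k - x = 0 then ((arrivalCount b m n (k - x + x) : ℂ) / (n.factorial : ℂ)) else 0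
        else 0) = if k < b then (arrivalCount b m n k : ℂ) / (n.factorial : ℂ) else 0 := by
      rw [← Finset.sum_congr rfl (g := fun x => if x ≤ k then
          if k - x = 0 then ((arrivalCount b m n (k - x + x) : ℂ) / (n.factorial : ℂ)) else 0
        else 0) (f := fun x => if x = k then (arrivalCount b m n k : ℂ) / (n.factorial : ℂ) else 0),
        Finset.sum_ite_eq']
      · simp
      · intro x _
        rcases lt_trichotomy x k with h | rfl | h
        · have : k - x ≠ 0 := by omega
          simp [h.ne, this]
        · simp
        · simp [h.ne', not_le.2 h]
    simp only [hdiv, hdiv', hle, hne, dvd_mul_right, true_or, if_true, if_false, hsum]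
    rcases lt_trichotomy k b with h | rfl | h
    · simp [not_le.2 h, h]
    · rw [← Finset.sum_div]
      simp [tableCount_succ_zero, Finset.sum_range_succ]
      ring
    · obtain ⟨j, rfl⟩ := Nat.exists_eq_add_of_lt h
      have h1 : b + j + 1 - b = j + 1 := by omega
      have h2 : j + 1 + b = b + j + 1 := by omega
      simp [h1, h2, h.le, not_lt.2 h.le, tableCount_succ_succ]

end Parking

/-! ### The kernel equation and its solution. -/

namespace Parking

section

open MvPowerSeries

/-- Replacing `z` by `b z`. -/
noncomputable abbrev scaleZ (b : ℕ) : Series →+* Series := rescale ![(b : ℂ), 1, 1]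

theorem coeff_scaleZ (b : ℕ) (f : Series) (d : Fin 3 →₀ ℕ) :
    coeff d (scaleZ b f) = (b : ℂ) ^ d 0 * coeff d f := by
  rw [coeff_rescale, Finsupp.prod_fintype _ _ (by simp), Fin.prod_univ_three]
  simp

theorem scaleZ_expAt (b : ℕ) : scaleZ b (expAt 1) = expAt b := by
  ext d
  rw [coeff_scaleZ, coeff_expAt, coeff_expAt]
  split_ifs <;> simp [div_eq_mul_inv]

theorem scaleZ_X_one (b : ℕ) : scaleZ b wVar = wVar := by
  classical
  ext d
  rw [coeff_scaleZ, wVar, coeff_X]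
  split_ifs with h <;> simp [h]

theorem scaleZ_X_two (b : ℕ) : scaleZ b qVar = qVar := by
  classical
  ext d
  rw [coeff_scaleZ, qVar, coeff_X]
  split_ifs with h <;> simp [h]

/-- The kernel `q ^ b - w ^ b * exp (b q z)`. -/
noncomputable def kernelSeries (b : ℕ) : Series := qVar ^ b - wVar ^ b * expAt b

/-- The coefficient of `q ^ b - q ^ s` in the functional equation of `Ω(b z, w, q)`. -/
noncomputable def boundarySeries (b s : ℕ) : Series :=
  wVar ^ b * scaleZ b (qCoeff s (expAt 1 * Omega b))

theorem kernelSeries_mul_OmegaScaled {b : ℕ} (hb : 1 ≤ b) :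
    kernelSeries b * OmegaScaled b =
      qVar ^ b + ∑ s ∈ Finset.range b, (qVar ^ b - qVar ^ s) * boundarySeries b s := by
  have h := congrArg (scaleZ b) (qVar_pow_mul_Omega hb)
  simp only [map_add, map_sub, map_mul, map_pow, map_sum, scaleZ_X_one, scaleZ_X_two,
    scaleZ_expAt] at h
  change qVar ^ b * OmegaScaled b = qVar ^ b + wVar ^ b * (expAt b * OmegaScaled b + _) at h
  rw [kernelSeries, sub_mul, h, mul_add, Finset.mul_sum]
  have : ∀ s, (qVar ^ b - qVar ^ s) * boundarySeries b s =
    wVar ^ b * ((qVar ^ b - qVar ^ s) * scaleZ b (qCoeff s (expAt 1 * Omega b))) := by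
    intro s
    rw [boundarySeries]
    ring
  simp only [this]
  ring

theorem zVar_ne_zero : zVar ≠ 0 := by
  intro h
  have h1 := congrArg (coeff (Finsupp.single 0 1)) h
  rw [zVar, coeff_index_single_self_X] at h1
  simp at h1

theorem kernelSeries_ne_zero {b : ℕ} (hb : 1 ≤ b) : kernelSeries b ≠ 0 := by
  intro h
  have h1 := congrArg (coeff (Finsupp.single 2 b)) h
  rw [kernelSeries, map_sub, wVar, qVar, coeff_X_pow_mul_apply, coeff_X_pow] at h1
  have : ¬ b ≤ 0 := by omega
  simp [this] at h1

theorem coeff_boundarySeries {b s : ℕ} {d : Fin 3 →₀ ℕ} (hd : d 2 ≠ 0) :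
    coeff d (boundarySeries b s) = 0 := by
  rw [boundarySeries, wVar, coeff_X_pow_mul_apply, coeff_scaleZ, coeff_qCoeff]
  simp [hd]

/-! ### The roots of the kernel -/

/-- `ω ^ j z w`. -/
noncomputable def treeArg (b j : ℕ) : Series := C (omegaRoot b ^ j) * zVar * wVar

theorem hasSubst_treeArg (b j : ℕ) : PowerSeries.HasSubst (treeArg b j) :=
  PowerSeries.HasSubst.of_constantCoeff_zero (by simp [treeArg, zVar])

/-- `exp (T(ω ^ j z w))`. -/
noncomputable def expTree (b j : ℕ) : Series :=
  PowerSeries.subst (treeArg b j) ((PowerSeries.exp ℂ).subst treeSeries)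

/-- The root `ω ^ j w exp (T(ω ^ j z w)) = T(ω ^ j z w) / z` of the kernel. -/
noncomputable def kernelRoot (b j : ℕ) : Series := C (omegaRoot b ^ j) * wVar * expTree b j

/-- The functional equation of `T` exhibits the factor `z`, so the quotient `T(ω^j zw)/z` is a
genuine power series. -/
theorem treeAt_eq (b j : ℕ) : treeAt b j = zVar * kernelRoot b j := by
  have h : treeAt b j = PowerSeries.subst (treeArg b j) treeSeries := rfl
  rw [h, treeSeries_eq, PowerSeries.subst_mul (hasSubst_treeArg b j),
    PowerSeries.subst_X (hasSubst_treeArg b j), kernelRoot, expTree, treeArg]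
  ring

theorem hasSubst_treeAt (b j : ℕ) : PowerSeries.HasSubst (treeAt b j) :=
  PowerSeries.HasSubst.of_constantCoeff_zero (by simp [treeAt_eq, zVar])

theorem expTree_eq (b j : ℕ) : expTree b j = (PowerSeries.exp ℂ).subst (treeAt b j) :=
  PowerSeries.subst_comp_subst_apply hasSubst_treeSeries (hasSubst_treeArg b j) _

theorem subst_natCast_mul_exp (b : ℕ) {t : Series} (ht : PowerSeries.HasSubst t) :
    (PowerSeries.exp ℂ).subst ((b : Series) * t) = (PowerSeries.exp ℂ).subst t ^ b := by
  have hb : PowerSeries.HasSubst ((b : ℂ) • (PowerSeries.X : PowerSeries ℂ)) :=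
    PowerSeries.HasSubst.smul_X' _
  rw [← PowerSeries.subst_pow ht, PowerSeries.exp_pow_eq_rescale_exp,
    PowerSeries.rescale_eq_subst, PowerSeries.subst_comp_subst_apply hb ht,
    PowerSeries.subst_smul ht, PowerSeries.subst_X ht]
  congr 1
  rw [Nat.cast_smul_eq_nsmul, nsmul_eq_mul]

/-- The factor `w` removes the constant term of the root, so it may replace `q` in any power series.
-/
theorem hasSubst_kernelRoot (b j : ℕ) : HasSubst ![zVar, wVar, kernelRoot b j] := by
  refine hasSubst_of_constantCoeff_zero fun i => ?_
  fin_cases i <;> simp [zVar, wVar, kernelRoot]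

/-- Replacing `q` by a root of the kernel. -/
noncomputable def evalRoot (b j : ℕ) : Series →ₐ[ℂ] Series :=
  substAlgHom (hasSubst_kernelRoot b j)

theorem evalRoot_zVar (b j : ℕ) : evalRoot b j zVar = zVar :=
  substAlgHom_X (hasSubst_kernelRoot b j) 0

theorem evalRoot_wVar (b j : ℕ) : evalRoot b j wVar = wVar :=
  substAlgHom_X (hasSubst_kernelRoot b j) 1

theorem evalRoot_qVar (b j : ℕ) : evalRoot b j qVar = kernelRoot b j :=
  substAlgHom_X (hasSubst_kernelRoot b j) 2

theorem evalRoot_of_coeff_eq_zero {b j : ℕ} {f : Series} (hf : ∀ d, d 2 ≠ 0 → coeff d f = 0) :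
    evalRoot b j f = f := by
  classical
  ext e
  have hprod : ∀ d : Fin 3 →₀ ℕ, d 2 = 0 →
      (d.prod fun s n => ![zVar, wVar, kernelRoot b j] s ^ n) = monomial d 1 := by
    intro d hd
    rw [Finsupp.prod_fintype _ _ (by simp), Fin.prod_univ_three]
    simp only [Matrix.cons_val, hd, pow_zero, mul_one, zVar, wVar, X_pow_eq,
      monomial_mul_monomial]
    have hsum : Finsupp.single 0 (d 0) + Finsupp.single 1 (d 1) = d := by
      refine Finsupp.ext fun i => ?_
      fin_cases i <;> simp [hd]
    rw [hsum]
  rw [evalRoot, substAlgHom_apply, coeff_subst (hasSubst_kernelRoot b j), finsum_eq_single _ e]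
  · by_cases h : e 2 = 0
    · simp [hprod e h]
    · simp [hf e h]
  · intro d hd
    by_cases h : d 2 = 0
    · simp [hprod d h, coeff_monomial, hd.symm]
    · simp [hf d h]

theorem evalRoot_expAt (b j : ℕ) : evalRoot b j (expAt b) = expTree b j ^ b := by
  have hs : PowerSeries.HasSubst ((b : Series) * qVar * zVar) :=
    PowerSeries.HasSubst.of_constantCoeff_zero (by simp [zVar])
  have h : evalRoot b j (expAt b) =
      (PowerSeries.exp ℂ).subst (evalRoot b j ((b : Series) * qVar * zVar)) := by
    rw [evalRoot, substAlgHom_apply, substAlgHom_apply, expAt]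
    exact subst_comp_subst_apply hs.const (hasSubst_kernelRoot b j) _
  rw [h, map_mul, map_mul, map_natCast, evalRoot_zVar, evalRoot_qVar, mul_assoc, mul_comm _ zVar,
    ← treeAt_eq, subst_natCast_mul_exp b (hasSubst_treeAt b j), expTree_eq]

theorem omegaRoot_isPrimitiveRoot {b : ℕ} (hb : 1 ≤ b) : IsPrimitiveRoot (omegaRoot b) b :=
  Complex.isPrimitiveRoot_exp b (by omega)

/-- At the root, `e^{bqz}` becomes `e^{bT}`, while the `b`-th power of the root is `w^b e^{bT}`
because `ω^{jb} = 1`. -/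
theorem evalRoot_kernelSeries {b : ℕ} (hb : 1 ≤ b) (j : ℕ) :
    evalRoot b j (kernelSeries b) = 0 := by
  have h : (omegaRoot b ^ j) ^ b = 1 := by
    rw [← pow_mul, mul_comm, pow_mul, (omegaRoot_isPrimitiveRoot hb).pow_eq_one, one_pow]
  rw [kernelSeries, map_sub, map_mul, map_pow, map_pow, evalRoot_qVar, evalRoot_wVar,
    evalRoot_expAt, kernelRoot, mul_pow, mul_pow, ← map_pow, h, map_one, one_mul, sub_self]

/-- The coefficient of `w` tells the `b` roots apart. -/
theorem coeff_kernelRoot (b j : ℕ) :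
    coeff (Finsupp.single 1 1) (kernelRoot b j) = omegaRoot b ^ j := by
  have h0 : constantCoeff (expTree b j) = 1 := by
    rw [expTree_eq, PowerSeries.constantCoeff_subst (hasSubst_treeAt b j), finsum_eq_single _ 0]
    · simp
    · intro n hn
      simp [treeAt_eq, zVar, hn]
  rw [kernelRoot, mul_assoc, coeff_C_mul, wVar, ← pow_one (X 1 : Series), coeff_X_pow_mul_apply]
  simp [h0]

theorem kernelRoot_injOn {b : ℕ} (hb : 1 ≤ b) :
    Set.InjOn (kernelRoot b) (Finset.range b : Set ℕ) := by
  intro i hi j hj h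
  have := congrArg (coeff (Finsupp.single 1 1)) h
  rw [coeff_kernelRoot, coeff_kernelRoot] at this
  exact (omegaRoot_isPrimitiveRoot hb).pow_inj (by simpa using hi) (by simpa using hj) this

end

instance : IsDomain Series := NoZeroDivisors.to_isDomain Series

/-! ### Factorization of the right-hand side of the functional equation -/

open Polynomial in
/-- The right-hand side of the functional equation, as a polynomial in `q`. -/
noncomputable def boundaryPoly (b : ℕ) : Polynomial Series :=
  X ^ b + ∑ s ∈ Finset.range b, (X ^ b - X ^ s) * C (boundarySeries b s)

theorem boundaryPoly_eval (b : ℕ) (x : Series) : (boundaryPoly b).eval x =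
    x ^ b + ∑ s ∈ Finset.range b, (x ^ b - x ^ s) * boundarySeries b s := by
  simp [boundaryPoly, Polynomial.eval_finsetSum]

theorem boundaryPoly_eval_kernelRoot {b : ℕ} (hb : 1 ≤ b) (j : ℕ) :
    (boundaryPoly b).eval (kernelRoot b j) = 0 := by
  have h := congrArg (evalRoot b j) (kernelSeries_mul_OmegaScaled hb)
  rw [map_mul, evalRoot_kernelSeries hb, zero_mul] at h
  simp only [map_add, map_sum, map_mul, map_sub, map_pow, evalRoot_qVar,
    evalRoot_of_coeff_eq_zero fun d hd => coeff_boundarySeries hd] at h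
  rw [boundaryPoly_eval, h]

-- Over a domain, a difference of degree below `b` with `b` distinct zeros vanishes.
open Polynomial in
theorem boundaryPoly_eq {b : ℕ} (hb : 1 ≤ b) : ∃ L : Series,
    boundaryPoly b = C L * ∏ j ∈ Finset.range b, (X - C (kernelRoot b j)) := by
  -- `L` is the coefficient of `X ^ b`, so the leading terms cancel in the difference.
  set L : Series := 1 + ∑ s ∈ Finset.range b, boundarySeries b s with hL
  set Q : Polynomial Series := ∏ j ∈ Finset.range b, (X - C (kernelRoot b j)) with hQ
  have hQm : Q.Monic := monic_prod_of_monic _ _ fun j _ => monic_X_sub_C _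
  have hQd : Q.natDegree = b := by
    rw [hQ, natDegree_prod_of_monic _ _ fun j _ => monic_X_sub_C _]
    simp
  refine ⟨L, eq_of_degree_sub_lt_of_eval_index_eq (v := kernelRoot b) (Finset.range b)
    (kernelRoot_injOn hb) ?_ ?_⟩
  · have h : boundaryPoly b - C L * Q = C L * (X ^ b - Q) -
        ∑ s ∈ Finset.range b, C (boundarySeries b s) * X ^ s := by
      have : ∑ s ∈ Finset.range b, (X ^ b - X ^ s) * C (boundarySeries b s) =
          X ^ b * C (∑ s ∈ Finset.range b, boundarySeries b s) -
            ∑ s ∈ Finset.range b, C (boundarySeries b s) * X ^ s := by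
        rw [map_sum, Finset.mul_sum, ← Finset.sum_sub_distrib]
        exact Finset.sum_congr rfl fun s _ => by ring
      rw [boundaryPoly, this, hL, map_add, map_one]
      ring
    rw [h, Finset.card_range, ← mem_degreeLT]
    refine Submodule.sub_mem _ ?_ (Submodule.sum_mem _ fun s hs => ?_)
    · rw [← smul_eq_C_mul]
      refine Submodule.smul_mem _ _ ?_
      rw [mem_degreeLT]
      have hb' : (X ^ b : Polynomial Series).degree = b := degree_X_pow b
      rw [← hb']
      refine degree_sub_lt_left ?_ (pow_ne_zero _ X_ne_zero) ?_
      · rw [hb', degree_eq_natDegree hQm.ne_zero, hQd]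
      · rw [hQm.leadingCoeff, (monic_X_pow b).leadingCoeff]
    · rw [mem_degreeLT]
      exact lt_of_le_of_lt (degree_C_mul_X_pow_le s _)
        (by exact_mod_cast Finset.mem_range.1 hs)
  · intro j hj
    rw [boundaryPoly_eval_kernelRoot hb, eval_mul, hQ, eval_prod, Finset.prod_eq_zero hj, mul_zero]
    simp

theorem kernel_identity {b : ℕ} (hb : 1 ≤ b) :
    (∏ j ∈ Finset.range b, (1 - kernelRoot b j)) ≠ 0 ∧
      kernelSeries b * OmegaScaled b * ∏ j ∈ Finset.range b, (1 - kernelRoot b j) =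
        ∏ j ∈ Finset.range b, (qVar - kernelRoot b j) := by
  obtain ⟨L, hL⟩ := boundaryPoly_eq hb
  have h1 := congrArg (Polynomial.eval 1) hL
  have h2 := congrArg (Polynomial.eval qVar) hL
  rw [boundaryPoly_eval] at h1 h2
  rw [← kernelSeries_mul_OmegaScaled hb] at h2
  simp only [one_pow, sub_self, zero_mul, Finset.sum_const_zero, add_zero, Polynomial.eval_mul,
    Polynomial.eval_C, Polynomial.eval_prod, Polynomial.eval_sub, Polynomial.eval_X] at h1 h2
  -- At `q = 1` every boundary term vanishes, so `1 = L ∏ (1 - root)`: this yields both the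
  -- nonvanishing and the elimination of `L`.
  refine ⟨right_ne_zero_of_mul (h1 ▸ one_ne_zero), ?_⟩
  rw [h2, mul_right_comm, ← h1, one_mul]

end Parking

theorem mainTheorem8 (b : ℕ) (hb : 1 ≤ b) :
    qF ^ b - wF ^ b * expF b ≠ 0 ∧
    (∏ j ∈ Finset.range b, (1 - treeF b j / zF)) ≠ 0 ∧
    toField (OmegaScaled b) =
      1 / (qF ^ b - wF ^ b * expF b) *
        ((∏ j ∈ Finset.range b, (qF - treeF b j / zF)) /
          (∏ j ∈ Finset.range b, (1 - treeF b j / zF))) := by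
  have hinj : Function.Injective toField := IsFractionRing.injective Series SeriesField
  have hz : zF ≠ 0 := (map_ne_zero_iff _ hinj).2 zVar_ne_zero
  have hroot : ∀ j, treeF b j / zF = toField (kernelRoot b j) := fun j => by
    rw [div_eq_iff hz, treeF, treeAt_eq, map_mul, mul_comm, zF]
  have hK : qF ^ b - wF ^ b * expF b = toField (kernelSeries b) := by
    simp [kernelSeries, qF, wF, expF]
  have hK0 : toField (kernelSeries b) ≠ 0 := (map_ne_zero_iff _ hinj).2 (kernelSeries_ne_zero hb)
  obtain ⟨h1, h2⟩ := kernel_identity hb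
  have hP : ∏ j ∈ Finset.range b, (1 - treeF b j / zF) =
      toField (∏ j ∈ Finset.range b, (1 - kernelRoot b j)) := by
    simp [hroot]
  have hR : ∏ j ∈ Finset.range b, (qF - treeF b j / zF) =
      toField (∏ j ∈ Finset.range b, (qVar - kernelRoot b j)) := by
    simp [hroot, qF]
  have hP0 : toField (∏ j ∈ Finset.range b, (1 - kernelRoot b j)) ≠ 0 :=
    (map_ne_zero_iff _ hinj).2 h1
  rw [hK, hP, hR, ← h2, map_mul, map_mul]
  refine ⟨hK0, hP0, ?_⟩
  field_simp
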